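/- Let $d\in\mathbb N$ and let $\Omega\subset\mathbb R^d$ be a bounded Lipschitz domain, that is, a nonempty, connected, bounded open set such that near every boundary point, in suitable orthonormal coordinates, $\Omega$ is the region strictly above the graph of a Lipschitz function. Let $\gamma$ be a finite positive Borel measure on $\Omega$. Let $\mathfrak M(\Omega;\mathbb R^d)$ be the space of $\mathbb R^d$-valued (finite Radon) measures on $\Omega$; for $g\in\mathfrak M(\Omega;\mathbb R^d)$ let $|g|$ be its variation measure, formed with the Euclidean norm on $\mathbb R^d$, and $\|g\|_{\mathfrak M}=|g|(\Omega)$. For $u\in L^1(\Omega)$ let $Du$ be its weak (distributional) gradient. Define $$\mathrm{TV}_{\mathrm{pwL}}^{\gamma}(u):=\min_{\substack{g\in\mathfrak M(\Omega;\mathbb R^d)\\ |g|\le\gamma}}\|Du-g\|_{\mathfrak M}\in[0,\infty],$$ where $|g|\le\gamma$ means that $\gamma-|g|$ is a positive measure, and $\|Du-g\|_{\mathfrak M}:=+\infty$ if $Du$ is not an element of $\mathfrak M(\Omega;\mathbb R^d)$. Then for every $u\in L^1(\Omega)$ the minimum is attained, and, as an identity in $[0,\infty]$, $$\mathrm{TV}_{\mathrm{pwL}}^{\gamma}(u)=\sup_{\substack{\varphi\in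 C_c^\infty(\Omega;\mathbb R^d)\\ |\varphi|\le 1}}\left\{\int_\Omega u\,\operatorname{div}\varphi\,dx-\int_\Omega|\varphi|\,d\gamma\right\},$$ where $|\varphi|$ denotes the pointwise Euclidean norm of $\varphi$. -/

import Mathlib

open MeasureTheory TopologicalSpace
open scoped ENNReal Distributions Gradient

noncomputable section

namespace TVpwL

/-- The set `Ω` is a bounded Lipschitz domain: it is nonempty, connected and bounded (openness is
part of the type), and near every boundary point `p` it is, in suitable orthonormal coordinates,
the region strictly above the graph of a Lipschitz function. Here `e` is the vertical direction
and `ψ` is a function of the coordinates orthogonal to `e`. -/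
structure IsBoundedLipschitzDomain {d : ℕ} (Ω : Opens (EuclideanSpace ℝ (Fin d))) : Prop where
  isConnected : IsConnected (Ω : Set (EuclideanSpace ℝ (Fin d)))
  isBounded : Bornology.IsBounded (Ω : Set (EuclideanSpace ℝ (Fin d)))
  lipschitz_boundary : ∀ p ∈ frontier (Ω : Set (EuclideanSpace ℝ (Fin d))),
    ∃ (e : EuclideanSpace ℝ (Fin d)) (ψ : (Submodule.span ℝ {e})ᗮ → ℝ) (K : NNReal) (r : ℝ),
      ‖e‖ = 1 ∧ LipschitzWith K ψ ∧ 0 < r ∧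
        ∀ x ∈ Metric.ball p r,
          x ∈ Ω ↔ ψ ((Submodule.span ℝ {e})ᗮ.orthogonalProjectionOnto x) < inner ℝ e x

/-- The divergence `∑ i, ∂φᵢ/∂xᵢ` of a vector field on `ℝᵈ`. -/
def divergence {d : ℕ} (φ : EuclideanSpace ℝ (Fin d) → EuclideanSpace ℝ (Fin d))
    (x : EuclideanSpace ℝ (Fin d)) : ℝ :=
  ∑ i, fderiv ℝ φ x (EuclideanSpace.single i 1) i

/-- The `ℝᵈ`-valued measure `μ` on `Ω` is the weak gradient `Du` of `u`:
`∫_Ω u ∇φ dx = - ∫_Ω φ dμ` in `ℝᵈ` for all scalar test functions `φ ∈ C_c^∞(Ω)`. (An `ℝᵈ`-valued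
measure on the Borel sets of `Ω` is automatically a finite Radon measure, and at most one `μ`
satisfies this.) -/
def IsWeakGradient {d : ℕ} (Ω : Opens (EuclideanSpace ℝ (Fin d)))
    (u : EuclideanSpace ℝ (Fin d) → ℝ) (μ : VectorMeasure Ω (EuclideanSpace ℝ (Fin d))) : Prop :=
  ∀ φ : 𝓓(Ω, ℝ), ∫ x in (Ω : Set (EuclideanSpace ℝ (Fin d))), u x • ∇ φ x =
    - ∫ᵛ x : Ω, φ x ∂•μ

/-- The Radon norm `‖Du - g‖ = |Du - g|(Ω)`, which is `+∞` if the distributional gradient `Du` is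
not an `ℝᵈ`-valued measure, i.e. if `u` is not of bounded variation. -/
def radonNormGradSub {d : ℕ} (Ω : Opens (EuclideanSpace ℝ (Fin d)))
    (u : EuclideanSpace ℝ (Fin d) → ℝ) (g : VectorMeasure Ω (EuclideanSpace ℝ (Fin d))) : ℝ≥0∞ :=
  ⨅ (μ : VectorMeasure Ω (EuclideanSpace ℝ (Fin d))) (_ : IsWeakGradient Ω u μ),
    (μ - g).variation Set.univ

/-- The functional `TV_pwL^γ(u)`: the infimum of `‖Du - g‖` over all `ℝᵈ`-valued measures `g` on
`Ω` whose variation measure satisfies `|g| ≤ γ`. -/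
def tvpwl {d : ℕ} (Ω : Opens (EuclideanSpace ℝ (Fin d))) (γ : Measure Ω)
    (u : EuclideanSpace ℝ (Fin d) → ℝ) : ℝ≥0∞ :=
  ⨅ (g : VectorMeasure Ω (EuclideanSpace ℝ (Fin d))) (_ : g.variation ≤ γ),
    radonNormGradSub Ω u g

end TVpwL

end

open scoped NNReal CompactlySupported InnerProductSpace

/-! Write `L φ` for the integral of `u div φ`. One inequality is direct: if `μ` is the weak gradient
and `|g| ≤ γ`, then `L φ = -∫ φ·d(μ - g) - ∫ φ·dg`, which for `|φ| ≤ 1` is at most `|μ - g|(Ω) + ∫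
|φ| dγ` (`le_of_isWeakGradient`).

For the converse, let the supremum `S` be finite. By scaling, `L φ ≤ S ‖φ‖_∞ + ∫ |φ| dγ`.
Hahn–Banach carries `L` to a functional `l` on all of `C_c(Ω; ℝᵈ)` with the same bound. The
remainder `J = l - ∫ |·| dγ` is not linear, but it is superadditive, and additive on fields whose
norms add. This is enough for `f ↦ sup {J φ : |φ| ≤ f}` to be additive on nonnegative functions, so
the Riesz–Markov–Kakutani theorem represents it by a measure `ν` of mass at most `S`
(`exists_measure_le_integral_norm`). Hence `L φ ≤ ∫ |φ| d(ν + γ)`.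

Then `L` has a density `k` with `|k| ≤ 1` with respect to `ν + γ`
(`exists_inner_density_of_le_integral_norm`). So `Du = -k(ν + γ)`, and `g = -kγ` is admissible with
`Du - g = -kν`, of norm at most `S`. The same `g` attains the minimum. -/

namespace TVpwL

/-! ### Hahn–Banach along a linear map -/

/-- **Hahn–Banach**: a linear functional dominated by the pullback of a sublinear map along a
linear map factors through a linear functional dominated by the sublinear map. -/
theorem exists_factor_of_le_sublinear {V W : Type*} [AddCommGroup V] [Module ℝ V]
    [AddCommGroup W] [Module ℝ W] (T : V →ₗ[ℝ] W) (L : V →ₗ[ℝ] ℝ) (N : W → ℝ)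
    (N_hom : ∀ c : ℝ, 0 < c → ∀ x, N (c • x) = c * N x) (N_add : ∀ x y, N (x + y) ≤ N x + N y)
    (hL : ∀ v, L v ≤ N (T v)) :
    ∃ l : W →ₗ[ℝ] ℝ, (∀ v, l (T v) = L v) ∧ ∀ w, l w ≤ N w := by
  have N_zero : N 0 = 0 := by
    have := N_hom 2 (by norm_num) 0
    rw [smul_zero] at this
    linarith
  -- Domination at `v` and at `-v` forces `L v = 0`, so `L` descends to the range of `T`; the
  -- section `s` transports it there.
  have hker : ∀ v, T v = 0 → L v = 0 := fun v hv => by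
    have h1 := hL v
    have h2 := hL (-v)
    rw [map_neg, map_neg, hv, neg_zero, N_zero] at h2
    rw [hv, N_zero] at h1
    linarith
  obtain ⟨s, hs⟩ := T.rangeRestrict.exists_rightInverse_of_surjective T.range_rangeRestrict
  have hTs : ∀ y : LinearMap.range T, T (s y) = y := fun y =>
    congrArg Subtype.val (LinearMap.congr_fun hs y)
  obtain ⟨l, hl, hlN⟩ := exists_extension_of_le_sublinear ⟨LinearMap.range T, L ∘ₗ s⟩ N N_hom N_add
    (fun y => by
      have := hL (s y)
      rwa [hTs] at this)
  refine ⟨l, fun v => ?_, hlN⟩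
  have h1 : l (T v) = L (s ⟨T v, v, rfl⟩) := hl ⟨T v, v, rfl⟩
  rw [h1, ← sub_eq_zero, ← map_sub]
  exact hker _ (by rw [map_sub, hTs, sub_self])

/-! ### A Riesz majorant for superadditive functionals of vector fields -/

section Majorant

variable {X E : Type*} [TopologicalSpace X] [NormedAddCommGroup E]

/-- The supremum of `J φ` over all compactly supported `φ` with `‖φ‖ ≤ f`. -/
noncomputable def majorant (J : C_c(X, E) → ℝ) (f : C_c(X, ℝ≥0)) : ℝ :=
  sSup (J '' {φ | ∀ x, ‖φ x‖ ≤ f x})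

variable {J : C_c(X, E) → ℝ} {S : ℝ}

lemma exists_bound (f : C_c(X, ℝ≥0)) : ∃ C : ℝ, 0 ≤ C ∧ ∀ x, (f x : ℝ) ≤ C := by
  obtain ⟨C, hC⟩ := f.toReal.continuous.bounded_above_of_compact_support f.toReal.hasCompactSupport
  refine ⟨max C 0, le_max_right _ _, fun x => le_trans ?_ (le_max_left _ _)⟩
  simpa using hC x

lemma le_majorant (hbdd : ∀ φ (C : ℝ), 0 ≤ C → (∀ x, ‖φ x‖ ≤ C) → J φ ≤ S * C)
    {f : C_c(X, ℝ≥0)} {φ : C_c(X, E)} (hφ : ∀ x, ‖φ x‖ ≤ f x) : J φ ≤ majorant J f := by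
  obtain ⟨C, hC, hf⟩ := exists_bound f
  refine le_csSup ⟨S * C, ?_⟩ ⟨φ, hφ, rfl⟩
  rintro _ ⟨ψ, hψ, rfl⟩
  exact hbdd ψ C hC fun x => (hψ x).trans (hf x)

lemma majorant_le {f : C_c(X, ℝ≥0)} {c : ℝ} (h : ∀ φ : C_c(X, E), (∀ x, ‖φ x‖ ≤ f x) → J φ ≤ c) :
    majorant J f ≤ c := by
  refine csSup_le ⟨J 0, 0, fun x => by simp, rfl⟩ ?_
  rintro _ ⟨ψ, hψ, rfl⟩
  exact h ψ hψ

variable [NormedSpace ℝ E]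

/-- A vector field of norm at most `f + g` splits into the sum of two positively proportional
fields of norm at most `f` and `g`. -/
lemma exists_proportional_split (f g : C_c(X, ℝ≥0)) (φ : C_c(X, E))
    (hφ : ∀ x, ‖φ x‖ ≤ (f + g) x) :
    ∃ ψ χ : C_c(X, E), φ = ψ + χ ∧ (∀ x, ‖ψ x‖ ≤ f x) ∧ (∀ x, ‖χ x‖ ≤ g x) ∧
      ∀ x, ‖φ x‖ = ‖ψ x‖ + ‖χ x‖ := by
  have key : ∀ f g : C_c(X, ℝ≥0), (∀ x, ‖φ x‖ ≤ (f x : ℝ) + g x) →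
      ∃ ψ : C_c(X, E), ∀ x, ψ x = ((f x : ℝ) / (f x + g x)) • φ x := fun f g h => by
    refine ⟨⟨⟨fun x => ((f x : ℝ) / (f x + g x)) • φ x, ?_⟩, φ.hasCompactSupport.smul_left⟩,
      fun x => rfl⟩
    rw [continuous_iff_continuousAt]
    intro x
    by_cases hx : (f x : ℝ) + g x = 0
    · have hφx : φ x = 0 := by
        have := h x
        rw [hx] at this
        exact norm_le_zero_iff.1 this
      -- The ratio need not be continuous at a zero of `f + g`, but it stays in `[0, 1]` while `φ`
      -- tends to `0` there.
      rw [ContinuousAt, hφx, smul_zero]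
      refine squeeze_zero_norm (fun y => ?_)
        (show Filter.Tendsto (fun y => ‖φ y‖) (nhds x) (nhds 0) from ?_)
      · rw [norm_smul, Real.norm_of_nonneg (by positivity)]
        exact mul_le_of_le_one_left (norm_nonneg _)
          (div_le_one_of_le₀ (by simp) (by positivity))
      · have : Filter.Tendsto (fun y => ‖φ y‖) (nhds x) (nhds ‖φ x‖) :=
          φ.continuous.norm.tendsto x
        rwa [hφx, norm_zero] at this
    · have h1 : Continuous fun x => (f x : ℝ) := NNReal.continuous_coe.comp f.continuous
      have h2 : Continuous fun x => (g x : ℝ) := NNReal.continuous_coe.comp g.continuous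
      exact (h1.continuousAt.div (h1.add h2).continuousAt hx).smul φ.continuous.continuousAt
  have hφ' : ∀ x, ‖φ x‖ ≤ (f x : ℝ) + g x := fun x => by simpa using hφ x
  obtain ⟨ψ, hψ⟩ := key f g hφ'
  obtain ⟨χ, hχ⟩ := key g f fun x => by rw [add_comm]; exact hφ' x
  have hbound : ∀ a b t : ℝ, 0 ≤ a → 0 ≤ b → 0 ≤ t → t ≤ a + b → a / (a + b) * t ≤ a := by
    intro a b t ha hb ht hab
    rcases eq_or_lt_of_le (add_nonneg ha hb) with h0 | h0
    · rw [← h0]; simpa using ha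
    · rw [div_mul_eq_mul_div, div_le_iff₀ h0]
      exact mul_le_mul_of_nonneg_left hab ha
  have hψn : ∀ x, ‖ψ x‖ = (f x : ℝ) / (f x + g x) * ‖φ x‖ := fun x => by
    rw [hψ, norm_smul, Real.norm_of_nonneg (by positivity)]
  have hχn : ∀ x, ‖χ x‖ = (g x : ℝ) / (g x + f x) * ‖φ x‖ := fun x => by
    rw [hχ, norm_smul, Real.norm_of_nonneg (by positivity)]
  have hsum : ∀ x, φ x = 0 ∨ (f x : ℝ) / (f x + g x) + (g x : ℝ) / (g x + f x) = 1 := fun x => by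
    by_cases hx : (f x : ℝ) + g x = 0
    · left
      have := hφ' x
      rw [hx] at this
      exact norm_le_zero_iff.1 this
    · right
      rw [add_comm (g x : ℝ), ← add_div, div_self hx]
  refine ⟨ψ, χ, ?_, fun x => ?_, fun x => ?_, fun x => ?_⟩
  · ext1 x
    rw [CompactlySupportedContinuousMap.add_apply, hψ, hχ, ← add_smul]
    rcases hsum x with h | h
    · simp [h]
    · rw [h, one_smul]
  · rw [hψn]
    exact hbound _ _ _ (by simp) (by simp) (norm_nonneg _) (hφ' x)
  · rw [hχn]
    exact hbound _ _ _ (by simp) (by simp) (norm_nonneg _) (by rw [add_comm]; exact hφ' x)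
  · rw [hψn, hχn, ← add_mul]
    rcases hsum x with h | h
    · simp [h]
    · rw [h, one_mul]

variable [T2Space X] [LocallyCompactSpace X] [MeasurableSpace X] [BorelSpace X]

/-- A functional on compactly supported vector fields that is superadditive, additive on
positively proportional fields, positively homogeneous, and bounded above by `S` times the uniform
norm is dominated by the integral of the norm against a measure of mass at most `S`. -/
theorem exists_measure_le_integral_norm (J : C_c(X, E) → ℝ) (S : ℝ) (h_zero : J 0 = 0)
    (h_super : ∀ φ ψ, J φ + J ψ ≤ J (φ + ψ))
    (h_split : ∀ φ ψ, (∀ x, ‖(φ + ψ) x‖ = ‖φ x‖ + ‖ψ x‖) → J (φ + ψ) ≤ J φ + J ψ)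
    (h_hom : ∀ (c : ℝ) φ, 0 < c → J (c • φ) = c * J φ)
    (hbdd : ∀ φ (C : ℝ), 0 ≤ C → (∀ x, ‖φ x‖ ≤ C) → J φ ≤ S * C) :
    ∃ ν : Measure X, ν Set.univ ≤ ENNReal.ofReal S ∧ ∀ φ, J φ ≤ ∫ x, ‖φ x‖ ∂ν := by
  have h_nonneg : ∀ f, 0 ≤ majorant J f := fun f => by
    have := le_majorant hbdd (f := f) (φ := 0) (by simp)
    rwa [h_zero] at this
  have h_smul_le : ∀ (c : ℝ≥0) f, 0 < c → c * majorant J f ≤ majorant J (c • f) := by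
    intro c f hc
    have hc' : (0 : ℝ) < c := hc
    rw [← le_div_iff₀' hc']
    refine majorant_le fun φ hφ => ?_
    rw [le_div_iff₀' hc', ← h_hom _ _ hc']
    refine le_majorant hbdd fun x => ?_
    rw [CompactlySupportedContinuousMap.smul_apply, CompactlySupportedContinuousMap.smul_apply,
      norm_smul, Real.norm_of_nonneg hc'.le, smul_eq_mul, NNReal.coe_mul]
    exact mul_le_mul_of_nonneg_left (hφ x) hc'.le
  let Λ : C_c(X, ℝ≥0) →ₗ[ℝ≥0] ℝ≥0 :=
    { toFun := fun f => ⟨majorant J f, h_nonneg f⟩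
      map_add' := fun f g => by
        apply NNReal.eq
        change majorant J (f + g) = majorant J f + majorant J g
        apply le_antisymm
        · refine majorant_le fun φ hφ => ?_
          -- Since the norms of the two pieces add up, `h_split` applies although `J` is not
          -- subadditive in general.
          obtain ⟨ψ, χ, rfl, hψ, hχ, hn⟩ := exists_proportional_split f g φ hφ
          exact (h_split ψ χ hn).trans (add_le_add (le_majorant hbdd hψ) (le_majorant hbdd hχ))
        -- The two suprema are taken one after the other, which leaves `h_super` for a single pair
        -- of fields.
        · rw [← le_sub_iff_add_le]
          refine majorant_le fun φ hφ => ?_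
          rw [le_sub_comm]
          refine majorant_le fun ψ hψ => ?_
          rw [le_sub_iff_add_le']
          refine (h_super φ ψ).trans (le_majorant hbdd fun x => ?_)
          exact (norm_add_le _ _).trans (by simpa using add_le_add (hφ x) (hψ x))
      map_smul' := fun c f => by
        apply NNReal.eq
        change majorant J (c • f) = c * majorant J f
        rcases eq_or_lt_of_le (zero_le (a := c)) with rfl | hc
        · rw [zero_smul, NNReal.coe_zero, zero_mul]
          refine le_antisymm (majorant_le fun φ hφ => ?_) (h_nonneg _)
          have : φ = 0 := by
            ext1 x
            have := hφ x
            simpa using this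
          rw [this, h_zero]
        · refine le_antisymm ?_ (h_smul_le c f hc)
          have hc' : (0 : ℝ) < c := hc
          -- The reverse inequality is the same one for the factor `c⁻¹` and the function `c • f`.
          have := h_smul_le c⁻¹ (c • f) (inv_pos.2 hc)
          rwa [smul_smul, inv_mul_cancel₀ hc.ne', one_smul, NNReal.coe_inv, inv_mul_le_iff₀ hc']
            at this }
  have hΛ : ∀ f, (Λ f : ℝ) = majorant J f := fun f => rfl
  refine ⟨NNRealRMK.rieszMeasure Λ, ?_, fun φ => ?_⟩
  -- Mass bound by inner regularity: a cutoff `F ≤ 1` equal to `1` on `K` dominates the measure of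
  -- `K`, and its majorant is at most `S` by `hbdd` with `C = 1`.
  · rw [isOpen_univ.measure_eq_iSup_isCompact]
    refine iSup₂_le fun K _ => iSup_le fun hK => ?_
    obtain ⟨F, hF1, -, hFc, hF⟩ := exists_continuous_one_zero_of_isCompact hK isClosed_empty
      (Set.disjoint_empty _)
    let f : C_c(X, ℝ≥0) := CompactlySupportedContinuousMap.nnrealPart ⟨F, hFc⟩
    have hfF : ∀ x, (f x : ℝ) = F x := fun x => Real.coe_toNNReal _ (hF x).1
    calc NNRealRMK.rieszMeasure Λ K = ∫⁻ x in K, 1 ∂(NNRealRMK.rieszMeasure Λ) := by simp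
      _ ≤ ∫⁻ x in K, f x ∂(NNRealRMK.rieszMeasure Λ) := by
          refine setLIntegral_mono' hK.measurableSet fun x hx => ?_
          have : f x = 1 := NNReal.eq (by rw [hfF, hF1 hx]; rfl)
          simp [this]
      _ ≤ ∫⁻ x, f x ∂(NNRealRMK.rieszMeasure Λ) := setLIntegral_le_lintegral _ _
      _ = Λ f := NNRealRMK.lintegral_rieszMeasure Λ f
      _ ≤ ENNReal.ofReal S := by
          rw [← ENNReal.ofReal_coe_nnreal, hΛ]
          refine ENNReal.ofReal_le_ofReal (majorant_le fun φ hφ => ?_)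
          rw [← mul_one S]
          exact hbdd φ 1 zero_le_one fun x => (hφ x).trans (by rw [hfF]; exact (hF x).2)
  -- With `f = ‖φ‖`, the field `φ` itself competes in the supremum defining the majorant.
  · let f : C_c(X, ℝ≥0) := ⟨⟨fun x => ‖φ x‖₊, φ.continuous.nnnorm⟩,
      φ.hasCompactSupport.comp_left nnnorm_zero⟩
    have := NNRealRMK.integral_rieszMeasure Λ f
    rw [hΛ] at this
    change ∫ x, ‖φ x‖ ∂_ = _ at this
    rw [this]
    exact le_majorant hbdd fun x => le_rfl

end Majorant

/-! ### Densities of norm at most one -/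

/-- The dual of `L¹` in the form needed for vector fields: a linear functional dominated by the
integral of the norm against a finite measure is integration against a field of norm at most one. -/
theorem exists_inner_density_of_le_integral_norm {V X E : Type*} [AddCommGroup V] [Module ℝ V]
    [MeasurableSpace X] [NormedAddCommGroup E] [InnerProductSpace ℝ E] [CompleteSpace E]
    (μ : Measure X) [IsFiniteMeasure μ]
    (ι : V →ₗ[ℝ] X → E) (hι : ∀ v, MemLp (ι v) 2 μ) (L : V →ₗ[ℝ] ℝ)
    (hL : ∀ v, L v ≤ ∫ x, ‖ι v x‖ ∂μ) :
    ∃ h : X → E, Integrable h μ ∧ (∀ᵐ x ∂μ, ‖h x‖ ≤ 1) ∧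
      ∀ v, L v = ∫ x, ⟪h x, ι v x⟫_ℝ ∂μ := by
  -- Working in `L²` makes the Hilbert space Riesz theorem available, while the dominating sublinear
  -- map remains the `L¹` norm, which is what bounds the density by one.
  let T : V →ₗ[ℝ] Lp E 2 μ :=
    { toFun := fun v => (hι v).toLp
      map_add' := fun v w => by
        rw [← MemLp.toLp_add]
        exact MemLp.toLp_congr _ _ (by rw [map_add])
      map_smul' := fun c v => by
        rw [RingHom.id_apply, ← MemLp.toLp_const_smul]
        exact MemLp.toLp_congr _ _ (by rw [map_smul]) }
  have hint : ∀ F : Lp E 2 μ, Integrable F μ := fun F => (Lp.memLp F).integrable (by norm_num)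
  obtain ⟨l, hlT, hl⟩ := exists_factor_of_le_sublinear T L (fun F => ∫ x, ‖F x‖ ∂μ)
    (fun c hc F => by
      rw [← integral_const_mul]
      refine integral_congr_ae ?_
      filter_upwards [Lp.coeFn_smul c F] with x hx
      rw [hx, Pi.smul_apply, norm_smul, Real.norm_of_nonneg hc.le])
    (fun F G => by
      rw [← integral_add (hint F).norm (hint G).norm]
      refine integral_mono_ae (hint _).norm ((hint F).norm.add (hint G).norm) ?_
      filter_upwards [Lp.coeFn_add F G] with x hx
      rw [hx]
      exact norm_add_le _ _)
    (fun v => (hL v).trans_eq (integral_congr_ae (by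
      filter_upwards [(hι v).coeFn_toLp] with x hx
      exact congrArg norm hx.symm)))
  -- The `L¹` norm is at most `μ(X)^(1/2)` times the `L²` norm, so `l` is continuous on `L²`.
  have hbound : ∀ F : Lp E 2 μ, ∫ x, ‖F x‖ ∂μ ≤ μ.real Set.univ ^ (1 / 2 : ℝ) * ‖F‖ := by
    intro F
    have h1 := eLpNorm_le_eLpNorm_mul_rpow_measure_univ (μ := μ) (p := 1) (q := 2) (by norm_num)
      (Lp.aestronglyMeasurable F)
    rw [integral_norm_eq_lintegral_enorm (Lp.aestronglyMeasurable F),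
      ← eLpNorm_one_eq_lintegral_enorm]
    refine (ENNReal.toReal_mono ?_ h1).trans_eq ?_
    · exact ENNReal.mul_ne_top (Lp.eLpNorm_ne_top F)
        (ENNReal.rpow_ne_top_of_nonneg (by norm_num) (measure_ne_top _ _))
    · rw [ENNReal.toReal_mul, Lp.norm_def, mul_comm, ← ENNReal.toReal_rpow]
      norm_num [Measure.real]
  let lc : StrongDual ℝ (Lp E 2 μ) := l.mkContinuous (μ.real Set.univ ^ (1 / 2 : ℝ)) fun F => by
    rw [Real.norm_eq_abs, abs_le]
    refine ⟨?_, (hl F).trans (hbound F)⟩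
    have := (hl (-F)).trans (hbound (-F))
    rw [map_neg, norm_neg] at this
    linarith
  let H : Lp E 2 μ := (InnerProductSpace.toDual ℝ _).symm lc
  have hH : ∀ F : Lp E 2 μ, l F = ∫ x, ⟪H x, F x⟫_ℝ ∂μ := fun F => by
    rw [← L2.inner_def]
    exact (InnerProductSpace.toDual_symm_apply (y := lc)).symm
  refine ⟨H, hint H, ?_, fun v => ?_⟩
  · have hHm : StronglyMeasurable H := Lp.stronglyMeasurable H
    -- Testing `l` on `H` cut off to `A` gives `∫_A ‖H‖² ≤ ∫_A ‖H‖`. As `‖H‖² > ‖H‖` on `A`, the set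
    -- `A` is null.
    let A : Set X := {x | 1 < ‖H x‖}
    have hA : MeasurableSet A := measurableSet_lt measurable_const hHm.norm.measurable
    have hAm : MemLp (A.indicator H) 2 μ := (Lp.memLp H).indicator hA
    have h1 : ∫ x in A, (‖H x‖ ^ 2 - ‖H x‖) ∂μ ≤ 0 := by
      have h2 := hl (hAm.toLp _)
      have e1 : l (hAm.toLp _) = ∫ x in A, ‖H x‖ ^ 2 ∂μ := by
        rw [hH, ← integral_indicator hA]
        refine integral_congr_ae ?_
        filter_upwards [hAm.coeFn_toLp] with x hx
        rw [hx]
        by_cases hxA : x ∈ A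
        · rw [Set.indicator_of_mem hxA, Set.indicator_of_mem hxA, real_inner_self_eq_norm_sq]
        · rw [Set.indicator_of_notMem hxA, Set.indicator_of_notMem hxA, inner_zero_right]
      have e2 : ∫ x, ‖hAm.toLp _ x‖ ∂μ = ∫ x in A, ‖H x‖ ∂μ := by
        rw [← integral_indicator hA]
        refine integral_congr_ae ?_
        filter_upwards [hAm.coeFn_toLp] with x hx
        rw [hx, norm_indicator_eq_indicator_norm]
      rw [e1, e2] at h2
      rw [integral_sub ((Lp.memLp H).integrable_norm_pow two_ne_zero).integrableOn
        (hint H).norm.integrableOn]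
      linarith
    have hpos : ∀ x ∈ A, 0 < ‖H x‖ ^ 2 - ‖H x‖ := fun x (hx : 1 < ‖H x‖) => by nlinarith
    have h3 : μ A = 0 := by
      by_contra hne
      refine absurd h1 (not_le.2 ?_)
      rw [setIntegral_pos_iff_support_of_nonneg_ae
        ((ae_restrict_iff' hA).2 (.of_forall fun x hx => (hpos x hx).le))
        (((Lp.memLp H).integrable_norm_pow two_ne_zero).sub (hint H).norm).integrableOn]
      refine (pos_iff_ne_zero.2 hne).trans_le (measure_mono fun x hx => ⟨(hpos x hx).ne', hx⟩)
    filter_upwards [measure_eq_zero_iff_ae_notMem.1 h3] with x hx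
    exact not_lt.1 hx
  · rw [← hlT, hH]
    refine integral_congr_ae ?_
    filter_upwards [(hι v).coeFn_toLp] with x hx
    exact congrArg (inner ℝ (H x)) hx

/-! ### Integration against vector measures -/

section VectorMeasure

variable {X E E' F G G' : Type*} [MeasurableSpace X]
  [NormedAddCommGroup E] [NormedSpace ℝ E] [NormedAddCommGroup E'] [NormedSpace ℝ E']
  [NormedAddCommGroup F] [NormedSpace ℝ F] [NormedAddCommGroup G] [NormedSpace ℝ G]
  [NormedAddCommGroup G'] [NormedSpace ℝ G']

/-- Integration against a vector measure commutes with continuous linear maps that intertwine the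
pairings. -/
theorem clm_integral_vectorMeasure [CompleteSpace G] [CompleteSpace G'] (m : VectorMeasure X F)
    (B : E →L[ℝ] F →L[ℝ] G) (B' : E' →L[ℝ] F →L[ℝ] G') (A : E →L[ℝ] E') (C : G →L[ℝ] G')
    (h : ∀ x y, C (B x y) = B' (A x) y) {f : X → E} (hf : Integrable f m.variation) :
    C (∫ᵛ x, f x ∂[B; m]) = ∫ᵛ x, A (f x) ∂[B'; m] := by
  refine hf.induction (P := fun f => C (∫ᵛ x, f x ∂[B; m]) = ∫ᵛ x, A (f x) ∂[B'; m])
    (fun c s hs hms => ?_) (fun f g _ hf hg ihf ihg => ?_) ?_ (fun f g hfg _ ihf => ?_)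
  · have : (fun x => A (s.indicator (fun _ => c) x)) = s.indicator fun _ => A c :=
      (Set.indicator_comp_of_zero (map_zero A)).symm
    rw [this, VectorMeasure.integral_eq_setToFun, VectorMeasure.integral_eq_setToFun,
      setToFun_indicator_const _ hs hms.ne, setToFun_indicator_const _ hs hms.ne]
    exact h c (m s)
  · simp only [Pi.add_apply, map_add]
    rw [VectorMeasure.integral_fun_add hf hg, map_add, ihf, ihg,
      VectorMeasure.integral_fun_add (A.integrable_comp hf) (A.integrable_comp hg)]
  · refine isClosed_eq (C.continuous.comp VectorMeasure.continuous_integral) ?_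
    have : ∀ f : X →₁[m.variation] E,
        ∫ᵛ x, A (f x) ∂[B'; m] = ∫ᵛ x, A.compLpL 1 m.variation f x ∂[B'; m] := fun f =>
      VectorMeasure.integral_congr_ae (A.coeFn_compLpL f).symm
    simp_rw [this]
    exact VectorMeasure.continuous_integral.comp (A.compLpL 1 m.variation).continuous
  · rw [← VectorMeasure.integral_congr_ae hfg, ihf]
    exact VectorMeasure.integral_congr_ae (hfg.fun_comp A)

lemma variation_withDensityᵥ_le_of_norm_le_one {ν : Measure X} {h : X → F} (hh : Integrable h ν)
    (h1 : ∀ᵐ x ∂ν, ‖h x‖ ≤ 1) : (ν.withDensityᵥ h).variation ≤ ν := by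
  refine VectorMeasure.variation_le_of_forall_enorm_le fun s hs => ?_
  rw [withDensityᵥ_apply hh hs]
  refine (enorm_integral_le_lintegral_enorm _).trans ?_
  refine (lintegral_mono_ae (g := fun _ => 1) (ae_restrict_of_ae ?_)).trans (by simp)
  filter_upwards [h1] with x hx
  rw [← ofReal_norm]
  exact ENNReal.ofReal_le_one.2 hx

/-- The integral against a vector measure with density of norm at most one. -/
theorem integral_withDensityᵥ_of_norm_le_one [CompleteSpace F] [CompleteSpace G] (ν : Measure X)
    (B : E →L[ℝ] F →L[ℝ] G) {h : X → F} (hh : Integrable h ν) (h1 : ∀ᵐ x ∂ν, ‖h x‖ ≤ 1)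
    {f : X → E} (hf : Integrable f ν) :
    ∫ᵛ x, f x ∂[B; ν.withDensityᵥ h] = ∫ x, B (f x) (h x) ∂ν := by
  have hle := variation_withDensityᵥ_le_of_norm_le_one hh h1
  have hBint : ∀ {f : X → E}, Integrable f ν → Integrable (fun x => B (f x) (h x)) ν := by
    intro f hf
    refine Integrable.mono' (hf.norm.const_mul ‖B‖)
      (B.aestronglyMeasurable_comp₂ hf.aestronglyMeasurable hh.aestronglyMeasurable) ?_
    filter_upwards [h1] with x hx
    refine (B.le_opNorm₂ _ _).trans (mul_le_of_le_one_right (by positivity) hx)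
  have hlip : ∀ f : X → E, Integrable f ν → ‖∫ x, B (f x) (h x) ∂ν‖ ≤ ‖B‖ * ∫ x, ‖f x‖ ∂ν := by
    intro f hf
    rw [← integral_const_mul]
    refine norm_integral_le_of_norm_le (hf.norm.const_mul _) ?_
    filter_upwards [h1] with x hx
    refine (B.le_opNorm₂ _ _).trans (mul_le_of_le_one_right (by positivity) hx)
  refine hf.induction
    (P := fun f => ∫ᵛ x, f x ∂[B; ν.withDensityᵥ h] = ∫ x, B (f x) (h x) ∂ν)
    (fun c s hs hms => ?_) (fun f g _ hf hg ihf ihg => ?_) ?_ (fun f g hfg _ ihf => ?_)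
  · have hms' := (hle s).trans_lt hms
    rw [VectorMeasure.integral_eq_setToFun, setToFun_indicator_const _ hs hms'.ne]
    change B c (ν.withDensityᵥ h s) = _
    rw [withDensityᵥ_apply hh hs, ← (B c).integral_comp_comm hh.integrableOn,
      ← integral_indicator hs]
    refine integral_congr_ae (.of_forall fun x => ?_)
    by_cases hx : x ∈ s <;> simp [hx]
  · simp only [Pi.add_apply, map_add, _root_.add_apply]
    rw [VectorMeasure.integral_fun_add (hf.mono_measure hle) (hg.mono_measure hle), ihf, ihg,
      integral_add (hBint hf) (hBint hg)]
  · refine isClosed_eq ?_ ?_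
    -- The variation is at most `ν`, so convergence in `L¹(ν)` implies `L¹` convergence for the
    -- variation.
    · rw [continuous_iff_continuousAt]
      intro f
      refine VectorMeasure.tendsto_integral_of_L1 _ ((L1.integrable_coeFn f).mono_measure hle).1
        (.of_forall fun g => (L1.integrable_coeFn g).mono_measure hle) ?_
      have : Filter.Tendsto (fun g : X →₁[ν] E => ∫⁻ x, ‖g x - f x‖ₑ ∂ν) (nhds f) (nhds 0) := by
        have h2 : Filter.Tendsto (fun g : X →₁[ν] E => edist g f) (nhds f) (nhds 0) :=
          tendsto_iff_edist_tendsto_0.1 Filter.tendsto_id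
        refine h2.congr fun g => ?_
        rw [L1.edist_def]
        simp only [edist_eq_enorm_sub]
      exact tendsto_of_tendsto_of_tendsto_of_le_of_le tendsto_const_nhds this
        (fun _ => zero_le) fun g => lintegral_mono' hle le_rfl
    · refine LipschitzWith.continuous (K := ‖B‖₊) (LipschitzWith.of_dist_le_mul fun f g => ?_)
      have hfi := L1.integrable_coeFn f
      have hgi := L1.integrable_coeFn g
      rw [dist_eq_norm, ← integral_sub (hBint hfi) (hBint hgi), L1.dist_eq_integral_dist]
      refine le_trans (le_of_eq ?_) ((hlip _ (hfi.sub hgi)).trans (le_of_eq ?_))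
      · simp
      · simp [dist_eq_norm]
  · have : f =ᵐ[(ν.withDensityᵥ h).variation] g := (Measure.absolutelyContinuous_of_le hle).ae_le hfg
    rw [← VectorMeasure.integral_congr_ae this, ihf]
    refine integral_congr_ae ?_
    filter_upwards [hfg] with x hx
    rw [hx]

end VectorMeasure

/-! ### Divergence and the scalar weak gradient -/

section Divergence

variable {d : ℕ}

lemma gradient_apply (f : EuclideanSpace ℝ (Fin d) → ℝ) (x : EuclideanSpace ℝ (Fin d))
    (i : Fin d) : (∇ f x) i = fderiv ℝ f x (EuclideanSpace.single i 1) := by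
  have := InnerProductSpace.toDual_symm_apply (𝕜 := ℝ) (x := EuclideanSpace.single i (1 : ℝ))
    (y := fderiv ℝ f x)
  rw [← this, EuclideanSpace.inner_single_right]
  simp [gradient]

variable {Ω : Opens (EuclideanSpace ℝ (Fin d))} {u : EuclideanSpace ℝ (Fin d) → ℝ}

lemma integrableOn_smul_of_hasCompactSupport {F : Type*} [NormedAddCommGroup F] [NormedSpace ℝ F]
    (hu : IntegrableOn u (Ω : Set (EuclideanSpace ℝ (Fin d))) volume)
    {g : EuclideanSpace ℝ (Fin d) → F} (hg : Continuous g) (hgc : HasCompactSupport g) :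
    IntegrableOn (fun x => u x • g x) (Ω : Set (EuclideanSpace ℝ (Fin d))) volume := by
  obtain ⟨C, hC⟩ := hg.bounded_above_of_compact_support hgc
  refine Integrable.mono' (hu.norm.mul_const C)
    (hu.aestronglyMeasurable.smul (hg.stronglyMeasurable_of_hasCompactSupport hgc
      ).aestronglyMeasurable) (.of_forall fun x => ?_)
  rw [norm_smul]
  exact mul_le_mul_of_nonneg_left (hC x) (norm_nonneg _)

lemma integrableOn_mul_fderiv {F : Type*} [NormedAddCommGroup F] [NormedSpace ℝ F]
    (hu : IntegrableOn u (Ω : Set (EuclideanSpace ℝ (Fin d))) volume)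
    (φ : 𝓓(Ω, F)) : IntegrableOn (fun x => u x • fderiv ℝ φ x) (Ω : Set _) volume :=
  integrableOn_smul_of_hasCompactSupport hu (φ.contDiff.continuous_fderiv (by simp))
    (φ.hasCompactSupport.fderiv ℝ)

lemma integral_smul_gradient_apply
    (hu : IntegrableOn u (Ω : Set (EuclideanSpace ℝ (Fin d))) volume)
    (φ : 𝓓(Ω, ℝ)) (i : Fin d) :
    (∫ x in (Ω : Set (EuclideanSpace ℝ (Fin d))), u x • ∇ φ x) i =
      ∫ x in (Ω : Set (EuclideanSpace ℝ (Fin d))),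
        u x * fderiv ℝ φ x (EuclideanSpace.single i 1) := by
  have hint : IntegrableOn (fun x => u x • ∇ φ x) (Ω : Set (EuclideanSpace ℝ (Fin d))) volume := by
    refine ((InnerProductSpace.toDual ℝ (EuclideanSpace ℝ (Fin d))).symm.toContinuousLinearEquiv
      |>.toContinuousLinearMap.integrable_comp (integrableOn_mul_fderiv hu φ)).congr
      (.of_forall fun x => ?_)
    change (InnerProductSpace.toDual ℝ _).symm (u x • fderiv ℝ φ x) = _
    rw [map_smulₛₗ]
    rfl
  refine ((EuclideanSpace.proj (𝕜 := ℝ) i).integral_comp_comm hint).symm.trans ?_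
  refine integral_congr_ae (.of_forall fun x => ?_)
  simp [gradient_apply]

/-- The distributional gradient of `u`, up to sign, as a functional on test vector fields. -/
noncomputable def integralMulDivergence
    (hu : IntegrableOn u (Ω : Set (EuclideanSpace ℝ (Fin d))) volume) :
    𝓓(Ω, EuclideanSpace ℝ (Fin d)) →ₗ[ℝ] ℝ where
  -- The trace is taken after integrating the full derivative, so linearity only needs integrability
  -- of `u • fderiv ℝ φ`.
  toFun φ := ∑ i, (∫ x in (Ω : Set (EuclideanSpace ℝ (Fin d))), u x • fderiv ℝ φ x)
    (EuclideanSpace.single i 1) i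
  map_add' φ ψ := by
    have : ∀ x, u x • fderiv ℝ (φ + ψ : 𝓓(Ω, EuclideanSpace ℝ (Fin d))) x =
        u x • fderiv ℝ φ x + u x • fderiv ℝ ψ x := fun x => by
      rw [FunLike.coe_add, fderiv_add (φ.contDiff.differentiable (by simp) x)
        (ψ.contDiff.differentiable (by simp) x), smul_add]
    simp_rw [this]
    rw [integral_add (integrableOn_mul_fderiv hu φ) (integrableOn_mul_fderiv hu ψ)]
    simp [Finset.sum_add_distrib]
  map_smul' c φ := by
    have : ∀ x, u x • fderiv ℝ (c • φ : 𝓓(Ω, EuclideanSpace ℝ (Fin d))) x =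
        c • u x • fderiv ℝ φ x := fun x => by
      rw [FunLike.coe_smul, fderiv_const_smul (φ.contDiff.differentiable (by simp) x), smul_comm]
    simp_rw [this]
    rw [integral_smul]
    simp [Finset.mul_sum]

lemma integralMulDivergence_apply
    (hu : IntegrableOn u (Ω : Set (EuclideanSpace ℝ (Fin d))) volume)
    (φ : 𝓓(Ω, EuclideanSpace ℝ (Fin d))) :
    integralMulDivergence hu φ =
      ∫ x in (Ω : Set (EuclideanSpace ℝ (Fin d))), u x * divergence φ x := by
  let D : (EuclideanSpace ℝ (Fin d) →L[ℝ] EuclideanSpace ℝ (Fin d)) →L[ℝ] ℝ :=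
    ∑ i, (EuclideanSpace.proj (𝕜 := ℝ) i : EuclideanSpace ℝ (Fin d) →L[ℝ] ℝ) ∘L
      ContinuousLinearMap.apply ℝ _ (EuclideanSpace.single i 1)
  have hD : ∀ A, D A = ∑ i, A (EuclideanSpace.single i 1) i := fun A => by
    simp [D]
  change ∑ i, (∫ x in _, u x • fderiv ℝ φ x) (EuclideanSpace.single i 1) i = _
  rw [← hD, ← D.integral_comp_comm (integrableOn_mul_fderiv hu φ)]
  refine integral_congr_ae (.of_forall fun x => ?_)
  exact (map_smul D _ _).trans (congrArg (u x * ·) (hD _))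

/-- The scalar test function `φᵢ`. -/
noncomputable def component (i : Fin d) (φ : 𝓓(Ω, EuclideanSpace ℝ (Fin d))) : 𝓓(Ω, ℝ) :=
  TestFunction.postcompCLM (EuclideanSpace.proj (𝕜 := ℝ) i) φ

lemma component_apply (i : Fin d) (φ : 𝓓(Ω, EuclideanSpace ℝ (Fin d)))
    (x : EuclideanSpace ℝ (Fin d)) : component i φ x = φ x i := rfl

/-- The test vector field `φ eᵢ`. -/
noncomputable def alongBasis (i : Fin d) (φ : 𝓓(Ω, ℝ)) : 𝓓(Ω, EuclideanSpace ℝ (Fin d)) :=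
  TestFunction.postcompCLM
    (ContinuousLinearMap.toSpanSingleton ℝ (EuclideanSpace.single i (1 : ℝ))) φ

lemma alongBasis_apply (i : Fin d) (φ : 𝓓(Ω, ℝ)) (x : EuclideanSpace ℝ (Fin d)) :
    alongBasis i φ x = φ x • EuclideanSpace.single i (1 : ℝ) := rfl

/-- Links vector test fields to the scalar test functions of `IsWeakGradient`: the component `φᵢ`
contributes only the `i`-th entry of its gradient integral. -/
lemma integralMulDivergence_eq_sum_gradient
    (hu : IntegrableOn u (Ω : Set (EuclideanSpace ℝ (Fin d))) volume)
    (φ : 𝓓(Ω, EuclideanSpace ℝ (Fin d))) :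
    integralMulDivergence hu φ =
      ∑ i, (∫ x in (Ω : Set (EuclideanSpace ℝ (Fin d))), u x • ∇ (component i φ) x) i := by
  rw [integralMulDivergence_apply]
  simp_rw [integral_smul_gradient_apply hu]
  rw [← integral_finsetSum]
  · refine integral_congr_ae (.of_forall fun x => ?_)
    simp only [divergence, Finset.mul_sum]
    refine Finset.sum_congr rfl fun i _ => ?_
    congr 1
    have : (component i φ : EuclideanSpace ℝ (Fin d) → ℝ) =
      (EuclideanSpace.proj (𝕜 := ℝ) i : EuclideanSpace ℝ (Fin d) →L[ℝ] ℝ) ∘ φ := rfl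
    rw [this, ((EuclideanSpace.proj (𝕜 := ℝ) i).hasFDerivAt.comp x
      (φ.contDiff.differentiable (by simp) x).hasFDerivAt).fderiv]
    rfl
  · intro i _
    exact (ContinuousLinearMap.apply ℝ ℝ (EuclideanSpace.single i (1 : ℝ))).integrable_comp
      (integrableOn_mul_fderiv hu (component i φ))

/-- The reverse link, by which a representation of the functional on vector fields yields the weak
gradient identity entry by entry. -/
lemma integralMulDivergence_alongBasis
    (hu : IntegrableOn u (Ω : Set (EuclideanSpace ℝ (Fin d))) volume)
    (i : Fin d) (φ : 𝓓(Ω, ℝ)) :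
    integralMulDivergence hu (alongBasis i φ) =
      (∫ x in (Ω : Set (EuclideanSpace ℝ (Fin d))), u x • ∇ φ x) i := by
  rw [integralMulDivergence_eq_sum_gradient, Finset.sum_eq_single i]
  · have : component i (alongBasis i φ) = φ := by
      ext x
      simp [component_apply, alongBasis_apply]
    rw [this]
  · intro j _ hj
    have : component j (alongBasis i φ) = 0 := by
      ext x
      simp [component_apply, alongBasis_apply, hj]
    rw [this]
    have h0 : ∀ x, ∇ (0 : EuclideanSpace ℝ (Fin d) → ℝ) x = 0 := fun x =>
      gradient_fun_const x (0 : ℝ)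
    simp [h0]
  · simp

end Divergence

/-! ### Test functions as compactly supported functions on `Ω` -/

section Restriction

variable {d : ℕ} {Ω : Opens (EuclideanSpace ℝ (Fin d))}

/-- Restriction of test functions to `Ω`. -/
noncomputable def restrict {F : Type*} [NormedAddCommGroup F] [NormedSpace ℝ F] :
    𝓓(Ω, F) →ₗ[ℝ] C_c(Ω, F) where
  toFun φ := ⟨⟨fun x => φ x, φ.continuous.comp continuous_subtype_val⟩, by
    refine HasCompactSupport.intro (K := Subtype.val ⁻¹' tsupport φ) ?_ fun x hx => ?_
    · rw [Topology.IsEmbedding.subtypeVal.isCompact_iff]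
      refine (congrArg IsCompact ?_).mpr φ.hasCompactSupport
      exact (Subtype.image_preimage_coe _ _).trans (Set.inter_eq_right.2 φ.tsupport_subset)
    · exact image_eq_zero_of_notMem_tsupport (f := φ) hx⟩
  map_add' _ _ := rfl
  map_smul' _ _ := rfl

lemma integrable_cc {X F : Type*} [TopologicalSpace X] [MeasurableSpace X]
    [OpensMeasurableSpace X] [NormedAddCommGroup F] (φ : C_c(X, F)) (γ : Measure X)
    [IsFiniteMeasure γ] : Integrable φ γ :=
  Continuous.integrable_of_hasCompactSupport φ.continuous φ.hasCompactSupport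

lemma memLp_two_cc {X F : Type*} [TopologicalSpace X] [MeasurableSpace X]
    [OpensMeasurableSpace X] [NormedAddCommGroup F] (φ : C_c(X, F)) (γ : Measure X)
    [IsFiniteMeasure γ] : MemLp φ 2 γ :=
  φ.continuous.memLp_of_hasCompactSupport φ.hasCompactSupport

end Restriction

/-! ### The supremum is at most the functional -/

section LowerBound

variable {d : ℕ} {Ω : Opens (EuclideanSpace ℝ (Fin d))} {u : EuclideanSpace ℝ (Fin d) → ℝ}

/-- Taking the `i`-th entry of `∫ φᵢ dm` amounts to pairing the field `φᵢ eᵢ` with `m`, and these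
fields sum to `φ`. -/
lemma sum_integral_component (m : VectorMeasure Ω (EuclideanSpace ℝ (Fin d)))
    [IsFiniteMeasure m.variation] (φ : 𝓓(Ω, EuclideanSpace ℝ (Fin d))) :
    ∑ i, (∫ᵛ x : Ω, component i φ x ∂•m) i = ∫ᵛ x : Ω, φ x ∂[innerSL ℝ; m] := by
  have h : ∀ i, (∫ᵛ x : Ω, component i φ x ∂•m) i =
      ∫ᵛ x : Ω, component i φ x • EuclideanSpace.single i (1 : ℝ) ∂[innerSL ℝ; m] := fun i =>
    clm_integral_vectorMeasure m (ContinuousLinearMap.lsmul ℝ ℝ) (innerSL ℝ)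
      (ContinuousLinearMap.toSpanSingleton ℝ (EuclideanSpace.single i (1 : ℝ)))
      (EuclideanSpace.proj (𝕜 := ℝ) i)
      (fun x y => by
        change x * y i = ⟪x • EuclideanSpace.single i (1 : ℝ), y⟫_ℝ
        rw [real_inner_smul_left, EuclideanSpace.inner_single_left]
        simp)
      (integrable_cc (restrict (component i φ)) _)
  simp_rw [h]
  rw [← VectorMeasure.integral_finsetSum]
  · congr 1
    ext1 x
    have := (EuclideanSpace.basisFun (Fin d) ℝ).sum_repr (φ x)
    simpa [component_apply] using this
  · intro i _
    exact (integrable_cc (restrict (component i φ)) _).smul_const _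

/-- Split `μ = (μ - g) + g`. Pairing `φ` with `μ - g` costs at most its total variation because `|φ|
≤ 1`; pairing with `g` costs at most `∫ |φ| dγ` because `|g| ≤ γ`. -/
lemma le_of_isWeakGradient (hu : IntegrableOn u (Ω : Set (EuclideanSpace ℝ (Fin d))) volume)
    {γ : Measure Ω} [IsFiniteMeasure γ] {μ g : VectorMeasure Ω (EuclideanSpace ℝ (Fin d))}
    (hμ : IsWeakGradient Ω u μ) (hg : g.variation ≤ γ)
    (hfin : (μ - g).variation Set.univ ≠ ∞) (φ : 𝓓(Ω, EuclideanSpace ℝ (Fin d)))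
    (hφ : ∀ x, ‖φ x‖ ≤ 1) :
    integralMulDivergence hu φ - ∫ x : Ω, ‖φ x‖ ∂γ ≤ (μ - g).variation.real Set.univ := by
  have : IsFiniteMeasure (μ - g).variation := ⟨hfin.lt_top⟩
  have hgf : IsFiniteMeasure g.variation := isFiniteMeasure_of_le _ hg
  have hμ' : μ = (μ - g) + g := (sub_add_cancel μ g).symm
  have hμf : IsFiniteMeasure μ.variation := by
    rw [hμ']
    exact isFiniteMeasure_of_le _ VectorMeasure.variation_add_le
  have hint : ∀ γ : Measure Ω, IsFiniteMeasure γ → Integrable (fun x : Ω => φ x) γ := fun γ _ =>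
    integrable_cc (restrict φ) γ
  have h1 : integralMulDivergence hu φ = -∫ᵛ x : Ω, φ x ∂[innerSL ℝ; μ] := by
    rw [integralMulDivergence_eq_sum_gradient, ← sum_integral_component, ← Finset.sum_neg_distrib]
    refine Finset.sum_congr rfl fun i _ => ?_
    rw [hμ (component i φ)]
    rfl
  have h2 : ∫ᵛ x : Ω, φ x ∂[innerSL ℝ; μ] =
      ∫ᵛ x : Ω, φ x ∂[innerSL ℝ; μ - g] + ∫ᵛ x : Ω, φ x ∂[innerSL ℝ; g] := by
    rw [← VectorMeasure.integral_add_vectorMeasure (hint _ inferInstance) (hint _ inferInstance),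
      sub_add_cancel]
  have hB : ‖(innerSL ℝ : EuclideanSpace ℝ (Fin d) →L[ℝ] _)‖ ≤ 1 := norm_innerSL_le ℝ
  have hbd : ∀ m : VectorMeasure Ω (EuclideanSpace ℝ (Fin d)),
      -∫ᵛ x : Ω, φ x ∂[innerSL ℝ; m] ≤ ∫ x : Ω, ‖φ x‖ ∂m.variation := fun m => by
    refine (neg_le_abs _).trans ?_
    rw [← Real.norm_eq_abs]
    refine VectorMeasure.norm_integral_le_integral_norm.trans ?_
    exact mul_le_of_le_one_left (integral_nonneg fun x => norm_nonneg _) hB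
  have h3 : ∫ x : Ω, ‖φ x‖ ∂g.variation ≤ ∫ x : Ω, ‖φ x‖ ∂γ :=
    integral_mono_measure hg (.of_forall fun x => norm_nonneg _) (hint γ inferInstance).norm
  have h4 : ∫ x : Ω, ‖φ x‖ ∂(μ - g).variation ≤ (μ - g).variation.real Set.univ := by
    refine (integral_mono (hint _ inferInstance).norm (integrable_const 1)
      fun x => hφ x).trans_eq (by simp)
  have h5 := hbd (μ - g)
  have h6 := hbd g
  rw [h1, h2]
  linarith

end LowerBound

/-! ### The functional is at most the supremum, with a minimizer -/

section UpperBound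

variable {d : ℕ} {Ω : Opens (EuclideanSpace ℝ (Fin d))} {u : EuclideanSpace ℝ (Fin d) → ℝ}

/-- The bound on the unit ball becomes sublinear domination by homogeneity. After the Hahn–Banach
extension, subtracting the `γ` term leaves a functional bounded by `S` times the uniform norm, to
which the Riesz majorant applies. -/
lemma exists_measure_dominating (hu : IntegrableOn u (Ω : Set (EuclideanSpace ℝ (Fin d))) volume)
    (γ : Measure Ω) [IsFiniteMeasure γ] {S : ℝ} (hS : 0 ≤ S)
    (h : ∀ φ : 𝓓(Ω, EuclideanSpace ℝ (Fin d)), (∀ x, ‖φ x‖ ≤ 1) →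
      integralMulDivergence hu φ - ∫ x : Ω, ‖φ x‖ ∂γ ≤ S) :
    ∃ ν : Measure Ω, ν Set.univ ≤ ENNReal.ofReal S ∧
      ∀ φ : 𝓓(Ω, EuclideanSpace ℝ (Fin d)),
        integralMulDivergence hu φ ≤ ∫ x : Ω, ‖φ x‖ ∂ν + ∫ x : Ω, ‖φ x‖ ∂γ := by
  let nrm : C_c(Ω, EuclideanSpace ℝ (Fin d)) → ℝ := fun φ => ‖φ.toBoundedContinuousFunction‖
  have hpt : ∀ (φ : C_c(Ω, EuclideanSpace ℝ (Fin d))) x, ‖φ x‖ ≤ nrm φ := fun φ x =>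
    φ.toBoundedContinuousFunction.norm_coe_le_norm x
  have hnrm_le : ∀ (φ : C_c(Ω, EuclideanSpace ℝ (Fin d))) (C : ℝ), 0 ≤ C → (∀ x, ‖φ x‖ ≤ C) →
      nrm φ ≤ C := fun φ C hC hφ => (BoundedContinuousFunction.norm_le hC).2 hφ
  have hint : ∀ (φ : C_c(Ω, EuclideanSpace ℝ (Fin d))), Integrable (fun x => ‖φ x‖) γ :=
    fun φ => (integrable_cc φ γ).norm
  have hγ_hom : ∀ (c : ℝ) (φ : C_c(Ω, EuclideanSpace ℝ (Fin d))), 0 < c →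
      ∫ x, ‖(c • φ) x‖ ∂γ = c * ∫ x, ‖φ x‖ ∂γ := fun c φ hc => by
    rw [← integral_const_mul]
    refine integral_congr_ae (.of_forall fun x => ?_)
    simp only [CompactlySupportedContinuousMap.smul_apply, norm_smul, Real.norm_of_nonneg hc.le]
  have hγ_add : ∀ φ ψ : C_c(Ω, EuclideanSpace ℝ (Fin d)),
      ∫ x, ‖(φ + ψ) x‖ ∂γ ≤ ∫ x, ‖φ x‖ ∂γ + ∫ x, ‖ψ x‖ ∂γ := fun φ ψ => by
    rw [← integral_add (hint φ) (hint ψ)]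
    exact integral_mono (hint _) ((hint φ).add (hint ψ)) fun x => norm_add_le _ _
  have hsub : ∀ φ : 𝓓(Ω, EuclideanSpace ℝ (Fin d)), integralMulDivergence hu φ ≤
      S * nrm (restrict φ) + ∫ x, ‖restrict φ x‖ ∂γ := by
    intro φ
    have hscale : ∀ c : ℝ, 0 < c → nrm (restrict φ) ≤ c → integralMulDivergence hu φ ≤
        S * c + ∫ x, ‖restrict φ x‖ ∂γ := by
      intro c hc hle
      have h1 := h (c⁻¹ • φ) fun x => by
        change ‖c⁻¹ • φ x‖ ≤ 1
        rw [norm_smul, norm_inv, Real.norm_of_nonneg hc.le, inv_mul_le_one₀ hc]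
        by_cases hx : x ∈ Ω
        · exact (hpt (restrict φ) ⟨x, hx⟩).trans hle
        · rw [image_eq_zero_of_notMem_tsupport fun hx' => hx (φ.tsupport_subset hx'), norm_zero]
          exact hc.le
      have h2 := hγ_hom c⁻¹ (restrict φ) (inv_pos.2 hc)
      rw [← map_smul] at h2
      change ∫ x : Ω, ‖(c⁻¹ • φ : 𝓓(Ω, EuclideanSpace ℝ (Fin d))) x‖ ∂γ = _ at h2
      rw [h2, map_smul, smul_eq_mul, ← mul_sub, inv_mul_le_iff₀ hc] at h1
      linarith
    refine le_of_forall_pos_le_add fun ε hε => ?_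
    -- The norm of `φ` may be zero, so the scaling factor is enlarged slightly; dividing by `S + 1`
    -- keeps the error below `ε` even when `S = 0`.
    have hS1 : 0 < S + 1 := by linarith
    have h3 := hscale (nrm (restrict φ) + ε / (S + 1))
      (add_pos_of_nonneg_of_pos (norm_nonneg _) (by positivity)) (le_add_of_nonneg_right
        (by positivity))
    have h4 : S * (ε / (S + 1)) ≤ ε := by
      rw [mul_div_assoc', div_le_iff₀ hS1]
      nlinarith
    linarith
  obtain ⟨l, hl, hlN⟩ := exists_factor_of_le_sublinear restrict (integralMulDivergence hu)
    (fun φ => S * nrm φ + ∫ x, ‖φ x‖ ∂γ)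
    (fun c hc φ => by
      have h1 : nrm (c • φ) = c * nrm φ := by
        change ‖c • φ.toBoundedContinuousFunction‖ = _
        rw [norm_smul, Real.norm_of_nonneg hc.le]
      rw [hγ_hom c φ hc, h1]
      ring)
    (fun φ ψ => by
      have h1 : nrm (φ + ψ) ≤ nrm φ + nrm ψ :=
        norm_add_le φ.toBoundedContinuousFunction ψ.toBoundedContinuousFunction
      have h2 := mul_le_mul_of_nonneg_left h1 hS
      have h3 := hγ_add φ ψ
      linarith)
    hsub
  have : LocallyCompactSpace Ω := Ω.isOpen.locallyCompactSpace
  -- Superadditivity is the triangle inequality under `-∫ ‖·‖ dγ`; when the norms add pointwise it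
  -- becomes an equality.
  obtain ⟨ν, hν, hJ⟩ := exists_measure_le_integral_norm (fun φ => l φ - ∫ x, ‖φ x‖ ∂γ) S (by simp)
    (fun φ ψ => by
      have := hγ_add φ ψ
      simp only [map_add]
      linarith)
    (fun φ ψ hn => by
      have : ∫ x, ‖(φ + ψ) x‖ ∂γ = ∫ x, ‖φ x‖ ∂γ + ∫ x, ‖ψ x‖ ∂γ := by
        rw [← integral_add (hint φ) (hint ψ)]
        exact integral_congr_ae (.of_forall hn)
      simp only [map_add, this]
      linarith)
    (fun c φ hc => by
      simp only [map_smul, hγ_hom c φ hc, smul_eq_mul]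
      ring)
    (fun φ C hC hφ => by
      have h1 := mul_le_mul_of_nonneg_left (hnrm_le φ C hC hφ) hS
      have h2 := hlN φ
      linarith)
  refine ⟨ν, hν, fun φ => ?_⟩
  have := hJ (restrict φ)
  rw [hl] at this
  exact sub_le_iff_le_add.1 this

/-- One density `k` serves both measures: `Du = -k(ν + γ)` splits into `g = -kγ`, which satisfies
`|g| ≤ γ`, and a remainder `-kν` of mass at most `ν(Ω) ≤ S`. The sign comes from integration by
parts. -/
theorem exists_variation_le_radonNormGradSub_le
    (hu : IntegrableOn u (Ω : Set (EuclideanSpace ℝ (Fin d))) volume)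
    (γ : Measure Ω) [IsFiniteMeasure γ] {S : ℝ} (hS : 0 ≤ S)
    (h : ∀ φ : 𝓓(Ω, EuclideanSpace ℝ (Fin d)), (∀ x, ‖φ x‖ ≤ 1) →
      integralMulDivergence hu φ - ∫ x : Ω, ‖φ x‖ ∂γ ≤ S) :
    ∃ g : VectorMeasure Ω (EuclideanSpace ℝ (Fin d)), g.variation ≤ γ ∧
      radonNormGradSub Ω u g ≤ ENNReal.ofReal S := by
  obtain ⟨ν, hν, hL⟩ := exists_measure_dominating hu γ hS h
  have : IsFiniteMeasure ν := ⟨hν.trans_lt ENNReal.ofReal_lt_top⟩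
  let ι : 𝓓(Ω, EuclideanSpace ℝ (Fin d)) →ₗ[ℝ] Ω → EuclideanSpace ℝ (Fin d) :=
    { toFun := fun φ x => φ x
      map_add' := fun _ _ => rfl
      map_smul' := fun _ _ => rfl }
  obtain ⟨k, hk, hk1, hkL⟩ := exists_inner_density_of_le_integral_norm (ν + γ) ι
    (fun φ => memLp_two_cc (restrict φ) (ν + γ)) (integralMulDivergence hu) (fun φ =>
      (hL φ).trans_eq (integral_add_measure (integrable_cc (restrict φ) ν).norm
        (integrable_cc (restrict φ) γ).norm).symm)
  have hkn : Integrable (-k) (ν + γ) := hk.neg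
  have hkn1 : ∀ᵐ x ∂(ν + γ), ‖(-k) x‖ ≤ 1 := by
    filter_upwards [hk1] with x hx
    rwa [Pi.neg_apply, norm_neg]
  obtain ⟨hkν, hkγ⟩ := integrable_add_measure.1 hkn
  obtain ⟨hkν1, hkγ1⟩ := ae_add_measure_iff.1 hkn1
  refine ⟨γ.withDensityᵥ (-k), variation_withDensityᵥ_le_of_norm_le_one hkγ hkγ1,
    (iInf₂_le ((ν + γ).withDensityᵥ (-k)) fun φ => ?_).trans ?_⟩
  · have hφ : Integrable (fun x : Ω => φ x) (ν + γ) := integrable_cc (restrict φ) _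
    rw [integral_withDensityᵥ_of_norm_le_one _ _ hkn hkn1 hφ]
    have hkφ : Integrable (fun x : Ω => φ x • (-k) x) (ν + γ) :=
      hkn.bdd_smul ‖(restrict φ).toBoundedContinuousFunction‖ hφ.aestronglyMeasurable
        (.of_forall fun x => (restrict φ).toBoundedContinuousFunction.norm_coe_le_norm x)
    ext i
    rw [← integralMulDivergence_alongBasis hu, hkL]
    change _ = -(EuclideanSpace.proj (𝕜 := ℝ) i (∫ x : Ω, φ x • (-k) x ∂(ν + γ)))
    rw [← (EuclideanSpace.proj (𝕜 := ℝ) i).integral_comp_comm hkφ, ← integral_neg]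
    refine integral_congr_ae (.of_forall fun x => ?_)
    change ⟪k x, φ x • EuclideanSpace.single i (1 : ℝ)⟫_ℝ = -(φ x * -(k x i))
    rw [inner_smul_right, EuclideanSpace.inner_single_right]
    simp
  · have : (ν + γ).withDensityᵥ (-k) - γ.withDensityᵥ (-k) = ν.withDensityᵥ (-k) := by
      rw [sub_eq_iff_eq_add]
      ext1 s hs
      rw [_root_.add_apply, withDensityᵥ_apply hkn hs, withDensityᵥ_apply hkν hs,
        withDensityᵥ_apply hkγ hs, Measure.restrict_add,
        integral_add_measure hkν.integrableOn hkγ.integrableOn]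
    rw [this]
    exact (variation_withDensityᵥ_le_of_norm_le_one hkν hkν1 _).trans hν

end UpperBound

end TVpwL

/-! ### Duality and attainment -/

theorem mainTheorem1 {d : ℕ} (Ω : Opens (EuclideanSpace ℝ (Fin d)))
    (hΩ : TVpwL.IsBoundedLipschitzDomain Ω) (γ : Measure Ω) [IsFiniteMeasure γ]
    (u : EuclideanSpace ℝ (Fin d) → ℝ)
    (hu : IntegrableOn u (Ω : Set (EuclideanSpace ℝ (Fin d))) volume) :
    -- the infimum defining the functional is a minimum
    (∃ g : VectorMeasure Ω (EuclideanSpace ℝ (Fin d)), g.variation ≤ γ ∧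
      TVpwL.radonNormGradSub Ω u g = TVpwL.tvpwl Ω γ u) ∧
    -- the dual formula, as an identity in the extended reals
    (TVpwL.tvpwl Ω γ u : EReal) =
      ⨆ (φ : 𝓓(Ω, EuclideanSpace ℝ (Fin d))) (_ : ∀ x, ‖φ x‖ ≤ 1),
        (((∫ x in (Ω : Set (EuclideanSpace ℝ (Fin d))), u x * TVpwL.divergence φ x) -
          ∫ x : Ω, ‖φ x‖ ∂γ : ℝ) : EReal) := by
  simp_rw [← TVpwL.integralMulDivergence_apply hu]
  set s : EReal := ⨆ (φ : 𝓓(Ω, EuclideanSpace ℝ (Fin d))) (_ : ∀ x, ‖φ x‖ ≤ 1),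
    ((TVpwL.integralMulDivergence hu φ - ∫ x : Ω, ‖φ x‖ ∂γ : ℝ) : EReal) with hs
  have hs_le : s ≤ TVpwL.tvpwl Ω γ u := by
    refine iSup₂_le fun φ hφ => ?_
    -- The bracket may be negative; truncating it at zero loses nothing, because the functional is
    -- nonnegative.
    have key : ENNReal.ofReal (TVpwL.integralMulDivergence hu φ - ∫ x : Ω, ‖φ x‖ ∂γ) ≤
        TVpwL.tvpwl Ω γ u := by
      refine le_iInf₂ fun g hg => le_iInf₂ fun μ hμ => ?_
      by_cases hfin : (μ - g).variation Set.univ = ∞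
      · rw [hfin]; exact le_top
      · rw [← ENNReal.ofReal_toReal hfin]
        exact ENNReal.ofReal_le_ofReal (TVpwL.le_of_isWeakGradient hu hμ hg hfin φ hφ)
    refine le_trans ?_ (EReal.coe_ennreal_le_coe_ennreal_iff.2 key)
    rw [EReal.coe_ennreal_ofReal]
    exact EReal.coe_le_coe_iff.2 (le_max_left _ _)
  have hs_nonneg : 0 ≤ s := by
    refine le_iSup₂_of_le 0 (fun x => by simp) ?_
    simp
  have attain : s ≠ ⊤ → ∃ g : VectorMeasure Ω (EuclideanSpace ℝ (Fin d)), g.variation ≤ γ ∧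
      (TVpwL.radonNormGradSub Ω u g : EReal) ≤ s := fun htop => by
    lift s to ℝ using ⟨htop, (EReal.bot_lt_zero.trans_le hs_nonneg).ne'⟩ with S
    have hS : 0 ≤ S := EReal.coe_nonneg.1 hs_nonneg
    obtain ⟨g, hg, hgS⟩ := TVpwL.exists_variation_le_radonNormGradSub_le hu γ hS fun φ hφ => by
      rw [← EReal.coe_le_coe_iff, hs]
      exact le_iSup₂ (f := fun (φ : 𝓓(Ω, EuclideanSpace ℝ (Fin d))) (_ : ∀ x, ‖φ x‖ ≤ 1) =>
        ((TVpwL.integralMulDivergence hu φ - ∫ x : Ω, ‖φ x‖ ∂γ : ℝ) : EReal)) φ hφ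
    refine ⟨g, hg, (EReal.coe_ennreal_le_coe_ennreal_iff.2 hgS).trans ?_⟩
    rw [EReal.coe_ennreal_ofReal, max_eq_left hS]
  have tv_le : ∀ g : VectorMeasure Ω (EuclideanSpace ℝ (Fin d)), g.variation ≤ γ →
      TVpwL.tvpwl Ω γ u ≤ TVpwL.radonNormGradSub Ω u g := fun g hg => iInf₂_le g hg
  -- If the supremum is infinite, so is the functional, and every admissible `g` is a minimizer; `g
  -- = 0` is used.
  by_cases htop : s = ⊤
  · rw [htop, top_le_iff] at hs_le
    have htv : TVpwL.tvpwl Ω γ u = ∞ := EReal.coe_ennreal_eq_top_iff.1 hs_le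
    have h0 : (0 : VectorMeasure Ω (EuclideanSpace ℝ (Fin d))).variation ≤ γ := by
      rw [VectorMeasure.variation_zero]
      exact Measure.zero_le γ
    refine ⟨⟨0, h0, le_antisymm ?_ (tv_le 0 h0)⟩, hs_le.trans htop.symm⟩
    rw [htv]
    exact le_top
  · obtain ⟨g, hg, hgs⟩ := attain htop
    refine ⟨⟨g, hg, le_antisymm ?_ (tv_le g hg)⟩, le_antisymm ?_ hs_le⟩
    · exact EReal.coe_ennreal_le_coe_ennreal_iff.1 (hgs.trans hs_le)
    · exact (EReal.coe_ennreal_le_coe_ennreal_iff.2 (tv_le g hg)).trans hgs
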